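/- Let $X$ be a compact metric space and let $A=C(X)$ be the $C^*$-algebra of continuous complex-valued functions on $X$. Then every countably generated Hilbert $C^*$-module $E$ over $A$ is $C^*$-reflexive. Here a Hilbert $C^*$-module over $A$ is an $A$-module $E$ with an $A$-valued inner product $\langle\cdot,\cdot\rangle$ that is complete in the norm $\|x\|=\|\langle x,x\rangle\|^{1/2}$; it is countably generated if it has a countable subset whose $A$-linear span is norm-dense in $E$. For a normed $A$-module $E$, the dual module $E'$ is the set of all bounded $A$-linear maps $f:E\to A$ with the operator norm and the scalar actions $(a\cdot f)(x)=f(x)a^*$ for $a\in A$ and $(\lambda f)(x)=\overline{\lambda}\,f(x)$ for $\lambda\in\mathbb C$, and $E''=(E')'$. The module $E$ is $C^*$-reflexive if the canonical $A$-linear map $E\to E''$, $x\mapsto\bigl(f\mapsto f(x)^*\bigr)$, is an isometric isomorphism of $E$ onto $E''$. -/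

import Mathlib

open scoped ComplexOrder

/-- The bounded `A`-linear maps from a normed (left) `A`-module `E` to the C⋆-algebra `A`, as a
subspace of the Banach space of bounded complex-linear maps `E → A`. -/
def boundedModuleMaps (A E : Type*) [CStarAlgebra A] [NormedAddCommGroup E] [NormedSpace ℂ E]
    [Module A E] : Submodule ℂ (E →L[ℂ] A) where
  carrier := {f | ∀ (a : A) (x : E), f (a • x) = a * f x}
  add_mem' := by
    intro f g hf hg a x
    simp [hf a x, hg a x, mul_add]
  zero_mem' := by
    intro a x
    simp
  smul_mem' := by
    intro c f hf a x
    simp [hf a x]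

/-- The `A`-dual module `E'` of a normed `A`-module `E`: all bounded `A`-linear maps `E → A`, with
the operator norm. It carries the usual Hilbert-module convention for the scalar actions, under
which the map `x ↦ ⟨x, ·⟩` is linear: `(c • f) x = conj c • f x` for `c : ℂ` and
`(a • f) x = f x * star a` for `a : A`. -/
def CStarDual (A E : Type*) [CStarAlgebra A] [NormedAddCommGroup E] [NormedSpace ℂ E]
    [Module A E] : Type _ :=
  ↥(boundedModuleMaps A E)

namespace CStarDual

variable {A E : Type*} [CStarAlgebra A] [NormedAddCommGroup E] [NormedSpace ℂ E] [Module A E]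

/-- The norm is the operator norm, the addition is pointwise. -/
noncomputable instance : NormedAddCommGroup (CStarDual A E) :=
  inferInstanceAs (NormedAddCommGroup ↥(boundedModuleMaps A E))

/-- The underlying bounded complex-linear map. -/
def toCLM (f : CStarDual A E) : E →L[ℂ] A := Subtype.val f

noncomputable instance : CoeFun (CStarDual A E) (fun _ => E → A) := ⟨fun f => f.toCLM⟩

/-- Build an element of the dual module from a bounded linear map that is `A`-linear. -/
def ofCLM (f : E →L[ℂ] A) (hf : ∀ (a : A) (x : E), f (a • x) = a * f x) : CStarDual A E :=
  ⟨f, hf⟩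

theorem ext {f g : CStarDual A E} (h : ∀ x, f x = g x) : f = g :=
  Subtype.ext (ContinuousLinearMap.ext h)

theorem map_smul (f : CStarDual A E) (a : A) (x : E) : f (a • x) = a * f x := f.2 a x

theorem norm_def (f : CStarDual A E) : ‖f‖ = ‖f.toCLM‖ := rfl

@[simp] theorem ofCLM_apply (f : E →L[ℂ] A) (hf) (x : E) :
    (ofCLM f hf : CStarDual A E) x = f x := rfl

@[simp] theorem zero_apply (x : E) : (0 : CStarDual A E) x = 0 := rfl

@[simp] theorem add_apply (f g : CStarDual A E) (x : E) : (f + g) x = f x + g x := rfl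

/-- The complex scalar action `(c • f) x = conj c • f x`. -/
noncomputable instance : SMul ℂ (CStarDual A E) where
  smul c f := ofCLM (star c • f.toCLM) fun a x => by simp [map_smul]

@[simp] theorem complex_smul_apply (c : ℂ) (f : CStarDual A E) (x : E) :
    (c • f) x = star c • f x := rfl

noncomputable instance : Module ℂ (CStarDual A E) where
  one_smul f := ext fun x => by simp
  mul_smul b c f := ext fun x => by simp [mul_smul]
  smul_zero c := ext fun x => by simp
  smul_add c f g := ext fun x => by simp
  add_smul b c f := ext fun x => by simp [add_smul]
  zero_smul f := ext fun x => by simp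

noncomputable instance : NormedSpace ℂ (CStarDual A E) where
  norm_smul_le c f := by
    change ‖star c • f.toCLM‖ ≤ ‖c‖ * ‖f.toCLM‖
    rw [norm_smul, norm_star]

/-- The action of the C⋆-algebra, `(a • f) x = f x * star a`. -/
noncomputable instance : SMul A (CStarDual A E) where
  smul a f := ofCLM (((ContinuousLinearMap.mul ℂ A).flip (star a)).comp f.toCLM) fun b x => by
    simp [map_smul, mul_assoc]

@[simp] theorem algebra_smul_apply (a : A) (f : CStarDual A E) (x : E) :
    (a • f) x = f x * star a := rfl

noncomputable instance : Module A (CStarDual A E) where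
  one_smul f := ext fun x => by simp
  mul_smul a b f := ext fun x => by simp [mul_assoc]
  smul_zero a := ext fun x => by simp
  smul_add a f g := ext fun x => by simp [add_mul]
  add_smul a b f := ext fun x => by simp [mul_add]
  zero_smul f := ext fun x => by simp

variable (A E) in
/-- The canonical `A`-linear map `E → E''`, `x ↦ (f ↦ star (f x))`. -/
noncomputable def toBidual : E →ₗ[A] CStarDual A (CStarDual A E) where
  toFun x := ofCLM
    (LinearMap.mkContinuous
      { toFun := fun f : CStarDual A E => star (f x)
        map_add' := fun f g => by simp
        map_smul' := fun c f => by simp }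
      ‖x‖
      (fun f => by
        change ‖star (f x)‖ ≤ ‖x‖ * ‖f‖
        rw [norm_star, mul_comm]
        exact f.toCLM.le_opNorm x))
    (fun a f => by
      change star ((a • f) x) = a * star (f x)
      simp)
  map_add' x y := ext fun f => by
    change star (f (x + y)) = star (f x) + star (f y)
    simp
  map_smul' a x := ext fun f => by
    change star (f (a • x)) = star (f x) * star a
    simp [map_smul]

theorem toBidual_apply (x : E) (f : CStarDual A E) : toBidual A E x f = star (f x) := rfl

end CStarDual

/-- A Hilbert `A`-module `E` is C⋆-reflexive if the canonical map `E → E''` is an isometric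
isomorphism of `E` onto its second dual module. -/
def IsCStarReflexive (A E : Type*) [CStarAlgebra A] [NormedAddCommGroup E] [NormedSpace ℂ E]
    [Module A E] : Prop :=
  Isometry (CStarDual.toBidual A E) ∧ Function.Surjective (CStarDual.toBidual A E)

/-- A normed `A`-module `E` is countably generated if there is a countable subset whose `A`-linear
span is dense in `E`. -/
def IsCountablyGeneratedModule (A E : Type*) [CStarAlgebra A] [NormedAddCommGroup E]
    [Module A E] : Prop :=
  ∃ S : Set E, S.Countable ∧ Dense (Submodule.span A S : Set E)

/-! View `E` as continuous sections of the Hilbert spaces `Fiber E x`. By Riesz, a bounded module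
map `f` is a bounded section `fiberRep f`, whose norm may be discontinuous: for `E = C₀((0,1])` over
`C([0,1])` the dual is all of `C_b((0,1])`. Isometry is easy; the point is surjectivity. Given `F`
in the bidual, let `g = restrictBidual F`. `F` is local (`norm_bidual_apply_le`), and a near-maximum
argument shows that it is determined by `g` (`bidual_eq_zero`). So it suffices that `g` comes from
`E`, which by a partition of unity (`exists_innerDual_eq`) is a local approximation question. If
approximation fails at `x₀`, humps in disjoint annuli shrinking to `x₀` are summed with alternating
signs. Countable generation makes the sum an element `f` of the dual, and locality forces `F f` to
oscillate at `x₀`, although it is a continuous function (`restrictBidual_locally_approx`). -/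

open Filter Topology

/-! ### The embedding of `E` in its dual, and isometry of the canonical map. -/

section InnerDual

variable {A E : Type*} [CStarAlgebra A] [PartialOrder A] [StarOrderedRing A]
  [NormedAddCommGroup E] [NormedSpace ℂ E] [Module A E] [CStarModule A E]

variable (A) in
/-- The element `⟨ξ, ·⟩` of the dual module. -/
noncomputable def innerDual (ξ : E) : CStarDual A E :=
  CStarDual.ofCLM (CStarModule.innerSL ξ) fun a η => by
    simp [CStarModule.innerSL_apply]

@[simp] theorem innerDual_apply (ξ η : E) : innerDual A ξ η = inner A ξ η := rfl

theorem norm_innerDual_le (ξ : E) : ‖innerDual A ξ‖ ≤ ‖ξ‖ :=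
  ContinuousLinearMap.opNorm_le_bound _ (norm_nonneg ξ) fun _ => CStarModule.norm_inner_le E

variable (A E) in
/-- The map `ξ ↦ ⟨ξ, ·⟩` as a bounded complex-linear map. -/
noncomputable def innerDualCLM : E →L[ℂ] CStarDual A E :=
  LinearMap.mkContinuous
    { toFun := innerDual A
      map_add' := fun ξ ζ => CStarDual.ext fun η => by simp
      map_smul' := fun c ξ => CStarDual.ext fun η => by simp }
    1 (fun ξ => by simpa using norm_innerDual_le (A := A) ξ)

@[simp] theorem innerDualCLM_apply (ξ : E) : innerDualCLM A E ξ = innerDual A ξ := rfl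

theorem innerDual_smul (a : A) (ξ : E) : innerDual A (a • ξ) = a • innerDual A ξ :=
  CStarDual.ext fun η => by simp

/-- The restriction of an element of the second dual module to `E`. -/
noncomputable def restrictBidual (F : CStarDual A (CStarDual A E)) : CStarDual A E :=
  CStarDual.ofCLM (F.toCLM.comp (innerDualCLM A E)) fun a ξ => by
    change F (innerDual A (a • ξ)) = a * F (innerDual A ξ)
    rw [innerDual_smul, CStarDual.map_smul]

@[simp] theorem restrictBidual_apply (F : CStarDual A (CStarDual A E)) (ξ : E) :
    restrictBidual F ξ = F (innerDual A ξ) := rfl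

theorem norm_toBidual (ξ : E) : ‖CStarDual.toBidual A E ξ‖ = ‖ξ‖ := by
  apply le_antisymm
  · refine ContinuousLinearMap.opNorm_le_bound _ (norm_nonneg ξ) fun f => ?_
    change ‖star (f ξ)‖ ≤ ‖ξ‖ * ‖f‖
    rw [norm_star, mul_comm]
    exact f.toCLM.le_opNorm ξ
  · rcases (norm_nonneg ξ).eq_or_lt with h | h
    · rw [← h]; exact norm_nonneg _
    · have h1 : ‖ξ‖ ^ 2 ≤ ‖CStarDual.toBidual A E ξ‖ * ‖ξ‖ := by
        calc ‖ξ‖ ^ 2 = ‖CStarDual.toBidual A E ξ (innerDual A ξ)‖ := by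
              rw [CStarDual.toBidual_apply, norm_star, innerDual_apply, CStarModule.norm_sq_eq A]
          _ ≤ ‖CStarDual.toBidual A E ξ‖ * ‖innerDual A ξ‖ :=
              (CStarDual.toBidual A E ξ).toCLM.le_opNorm _
          _ ≤ _ := by gcongr; exact norm_innerDual_le ξ
      nlinarith

variable (A E) in
theorem isometry_toBidual : Isometry (CStarDual.toBidual A E) :=
  AddMonoidHomClass.isometry_of_norm _ norm_toBidual

end InnerDual

/-! ### Fibers, and dual elements as bounded sections. -/

section Fiber

variable {X : Type*} [TopologicalSpace X] [CompactSpace X]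
  {E : Type*} [NormedAddCommGroup E] [NormedSpace ℂ E] [Module C(X, ℂ) E] [CStarModule C(X, ℂ) E]

/-- The Hilbert module `E`, viewed with the semi-inner product `⟨·, ·⟩(x)`. -/
def PreFiber (E : Type*) {X : Type*} (_ : X) : Type _ := E

namespace PreFiber

instance (x : X) : AddCommGroup (PreFiber E x) := inferInstanceAs (AddCommGroup E)
noncomputable instance (x : X) : Module ℂ (PreFiber E x) := inferInstanceAs (Module ℂ E)

/-- The semi-inner product `⟨·, ·⟩(x)`. -/
@[reducible] noncomputable def core (x : X) : PreInnerProductSpace.Core ℂ (PreFiber E x) where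
  inner ξ η := inner C(X, ℂ) (show E from ξ) (show E from η) x
  conj_inner_symm ξ η := by
    rw [← CStarModule.star_inner (A := C(X, ℂ)) (show E from η) (show E from ξ)]; rfl
  re_inner_nonneg ξ := by
    have h := (CStarModule.inner_self_nonneg (A := C(X, ℂ)) (x := (show E from ξ)))
    exact (Complex.nonneg_iff.mp (ContinuousMap.le_def.mp h x)).1
  add_left ξ η ζ := by
    exact congrArg (fun a : C(X, ℂ) => a x) (CStarModule.inner_add_left (A := C(X, ℂ)) (E := E))
  smul_left ξ η c := by
    exact congrArg (fun a : C(X, ℂ) => a x)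
      (CStarModule.inner_smul_left_complex (A := C(X, ℂ)) (E := E))

noncomputable instance (x : X) : SeminormedAddCommGroup (PreFiber E x) :=
  @InnerProductSpace.Core.toSeminormedAddCommGroup ℂ _ _ _ _ (core x)

noncomputable instance (x : X) : InnerProductSpace ℂ (PreFiber E x) :=
  InnerProductSpace.ofCore (core x)

end PreFiber

/-- The fiber of the Hilbert module `E` at a point `x`. -/
abbrev Fiber (E : Type*) [NormedAddCommGroup E] [NormedSpace ℂ E] [Module C(X, ℂ) E]
    [CStarModule C(X, ℂ) E] (x : X) : Type _ :=
  UniformSpace.Completion (PreFiber E x)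

variable (E) in
/-- The value of an element of `E` in the fiber over `x`. -/
noncomputable def fiberMap (x : X) : E →ₗ[ℂ] Fiber E x where
  toFun ξ := ((show PreFiber E x from ξ) : UniformSpace.Completion (PreFiber E x))
  map_add' ξ η := UniformSpace.Completion.coe_add (α := PreFiber E x) ξ η
  map_smul' c ξ := UniformSpace.Completion.coe_smul (X := PreFiber E x) c ξ

theorem inner_fiberMap (x : X) (ξ η : E) :
    inner ℂ (fiberMap E x ξ) (fiberMap E x η) = inner C(X, ℂ) ξ η x :=
  UniformSpace.Completion.inner_coe (𝕜 := ℂ) (E := PreFiber E x) ξ η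

theorem denseRange_fiberMap (x : X) : DenseRange (fiberMap E x) :=
  UniformSpace.Completion.denseRange_coe (α := PreFiber E x)

theorem exists_norm_fiberMap_sub_lt (x : X) (v : Fiber E x) {ε : ℝ} (hε : 0 < ε) :
    ∃ ξ : E, ‖fiberMap E x ξ - v‖ < ε := by
  obtain ⟨ξ, hξ⟩ := (denseRange_fiberMap x).exists_dist_lt v hε
  exact ⟨ξ, by rwa [← dist_eq_norm, dist_comm]⟩

theorem norm_fiberMap_sq (x : X) (ξ : E) : ‖fiberMap E x ξ‖ ^ 2 = ‖inner C(X, ℂ) ξ ξ x‖ := by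
  rw [← inner_fiberMap, inner_self_eq_norm_sq_to_K]
  simp

theorem norm_fiberMap_le (x : X) (ξ : E) : ‖fiberMap E x ξ‖ ≤ ‖ξ‖ := by
  refine le_of_sq_le_sq ?_ (norm_nonneg ξ)
  rw [norm_fiberMap_sq, CStarModule.norm_sq_eq C(X, ℂ)]
  exact ContinuousMap.norm_coe_le_norm _ x

theorem norm_le_of_norm_fiberMap_le {ξ : E} {C : ℝ} (hC : 0 ≤ C)
    (h : ∀ x : X, ‖fiberMap E x ξ‖ ≤ C) : ‖ξ‖ ≤ C := by
  refine le_of_sq_le_sq ?_ hC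
  rw [CStarModule.norm_sq_eq C(X, ℂ), ContinuousMap.norm_le _ (sq_nonneg C)]
  intro x
  rw [← norm_fiberMap_sq]
  exact pow_le_pow_left₀ (norm_nonneg _) (h x) 2

/-- This continuity is what separates sections from `E` from those of general dual elements; the
later estimates are arranged to use only it and the continuity of `f ξ`. -/
theorem continuous_norm_fiberMap (ξ : E) : Continuous fun x : X => ‖fiberMap E x ξ‖ := by
  have : (fun x : X => ‖fiberMap E x ξ‖) = fun x => √‖inner C(X, ℂ) ξ ξ x‖ := by
    ext x; rw [← norm_fiberMap_sq, Real.sqrt_sq (norm_nonneg _)]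
  rw [this]; fun_prop

theorem fiber_ext {x : X} {v w : Fiber E x}
    (h : ∀ η : E, inner ℂ v (fiberMap E x η) = inner ℂ w (fiberMap E x η)) : v = w := by
  refine ext_inner_right ℂ fun u => ?_
  refine congrFun ((denseRange_fiberMap x).equalizer ?_ ?_ (funext h)) u <;> fun_prop

theorem norm_le_of_norm_inner_fiberMap_le {x : X} {v : Fiber E x} {C : ℝ} (hC : 0 ≤ C)
    (h : ∀ η : E, ‖(inner ℂ v (fiberMap E x η) : ℂ)‖ ≤ C * ‖fiberMap E x η‖) : ‖v‖ ≤ C := by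
  have h1 : ∀ u : Fiber E x, ‖(inner ℂ v u : ℂ)‖ ≤ C * ‖u‖ := fun u =>
    (denseRange_fiberMap x).induction_on u (isClosed_le (by fun_prop) (by fun_prop)) h
  have h2 := h1 v
  rw [inner_self_eq_norm_sq_to_K, norm_pow, RCLike.norm_ofReal, abs_norm] at h2
  nlinarith [norm_nonneg v]

theorem fiberMap_smul (x : X) (a : C(X, ℂ)) (ξ : E) :
    fiberMap E x (a • ξ) = a x • fiberMap E x ξ :=
  fiber_ext fun η => by
    rw [inner_fiberMap, inner_smul_left, inner_fiberMap, CStarModule.inner_op_smul_left, mul_comm]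
    rfl

/-- A bounded module map is bounded in each fiber. -/
theorem norm_apply_le_norm_fiberMap (f : CStarDual C(X, ℂ) E) (η : E) (x : X) :
    ‖f η x‖ ≤ ‖f‖ * ‖fiberMap E x η‖ := by
  have key : ∀ δ : ℝ, 0 < δ → ‖f η x‖ ≤ ‖f‖ * (‖fiberMap E x η‖ + δ) := by
    intro δ hδ
    have hpos : ∀ y : X, 0 < ‖fiberMap E y η‖ + δ := fun y => by positivity
    -- Rescaling by `a` makes `η` of norm at most one in every fiber at once; `δ` keeps `a`
    -- continuous where `η` vanishes.
    let a : C(X, ℂ) := ⟨fun y => (((‖fiberMap E y η‖ + δ)⁻¹ : ℝ) : ℂ),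
      Complex.continuous_ofReal.comp
        (((continuous_norm_fiberMap η).add continuous_const).inv₀ fun y => (hpos y).ne')⟩
    have ha : ∀ y, ‖a y‖ = (‖fiberMap E y η‖ + δ)⁻¹ := fun y => by
      change ‖(((‖fiberMap E y η‖ + δ)⁻¹ : ℝ) : ℂ)‖ = _
      rw [Complex.norm_real, Real.norm_of_nonneg (inv_nonneg.mpr (hpos y).le)]
    have h1 : ‖a • η‖ ≤ 1 := norm_le_of_norm_fiberMap_le zero_le_one fun y => by
      rw [fiberMap_smul, norm_smul, ha, inv_mul_le_one₀ (hpos y)]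
      linarith
    have h2 : ‖f (a • η) x‖ ≤ ‖f‖ := by
      refine (ContinuousMap.norm_coe_le_norm _ x).trans ?_
      refine (f.toCLM.le_opNorm _).trans ?_
      exact mul_le_of_le_one_right (norm_nonneg _) h1
    rw [CStarDual.map_smul, ContinuousMap.mul_apply, norm_mul, ha, inv_mul_le_iff₀ (hpos x)] at h2
    linarith
  have hlim : Tendsto (fun δ : ℝ => ‖f‖ * (‖fiberMap E x η‖ + δ)) (𝓝[>] 0)
      (𝓝 (‖f‖ * (‖fiberMap E x η‖ + 0))) :=
    (Continuous.tendsto (by fun_prop) 0).mono_left nhdsWithin_le_nhds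
  rw [add_zero] at hlim
  exact ge_of_tendsto hlim (eventually_mem_nhdsWithin.mono key)

/-- The functional induced on the fiber by a bounded module map. -/
noncomputable def fiberFunctional (f : CStarDual C(X, ℂ) E) (x : X) : PreFiber E x →L[ℂ] ℂ :=
  LinearMap.mkContinuous
    { toFun := fun ξ => f (show E from ξ) x
      map_add' := fun ξ η => by
        exact congrArg (fun a : C(X, ℂ) => a x) (f.toCLM.map_add (show E from ξ) (show E from η))
      map_smul' := fun c ξ => by
        exact congrArg (fun a : C(X, ℂ) => a x) (f.toCLM.map_smul c (show E from ξ)) }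
    ‖f‖ (fun ξ => by
      have := norm_apply_le_norm_fiberMap f (show E from ξ) x
      have h : ‖fiberMap E x (show E from ξ)‖ = ‖ξ‖ := UniformSpace.Completion.norm_coe ξ
      rwa [h] at this)

/-- The vector representing a bounded module map in the fiber over `x`. -/
noncomputable def fiberRep (f : CStarDual C(X, ℂ) E) (x : X) : Fiber E x :=
  (InnerProductSpace.toDual ℂ (Fiber E x)).symm
    ((fiberFunctional f x).extend (UniformSpace.Completion.toComplL (𝕜 := ℂ)))

@[simp] theorem inner_fiberRep (f : CStarDual C(X, ℂ) E) (x : X) (η : E) :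
    inner ℂ (fiberRep f x) (fiberMap E x η) = f η x := by
  rw [fiberRep, InnerProductSpace.toDual_symm_apply]
  exact ContinuousLinearMap.extend_eq (e := UniformSpace.Completion.toComplL (𝕜 := ℂ)) _
    (UniformSpace.Completion.denseRange_coe (α := PreFiber E x))
    (UniformSpace.Completion.isUniformInducing_coe (PreFiber E x)) (show PreFiber E x from η)

theorem norm_fiberRep_le (f : CStarDual C(X, ℂ) E) (x : X) : ‖fiberRep f x‖ ≤ ‖f‖ :=
  norm_le_of_norm_inner_fiberMap_le (norm_nonneg f) fun η => by
    rw [inner_fiberRep]; exact norm_apply_le_norm_fiberMap f η x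

/-- Together with `norm_fiberRep_le`, this identifies the dual norm with the supremum of the fiber
norms. -/
theorem norm_le_of_norm_fiberRep_le {f : CStarDual C(X, ℂ) E} {C : ℝ} (hC : 0 ≤ C)
    (h : ∀ x, ‖fiberRep f x‖ ≤ C) : ‖f‖ ≤ C := by
  refine ContinuousLinearMap.opNorm_le_bound _ hC fun η => ?_
  refine (ContinuousMap.norm_le _ (by positivity)).mpr fun x => ?_
  change ‖f η x‖ ≤ _
  rw [← inner_fiberRep]
  refine (norm_inner_le_norm _ _).trans ?_
  gcongr
  · exact h x
  · exact norm_fiberMap_le x η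

@[simp] theorem fiberRep_innerDual (ξ : E) (x : X) :
    fiberRep (innerDual C(X, ℂ) ξ) x = fiberMap E x ξ :=
  fiber_ext fun η => by rw [inner_fiberRep, inner_fiberMap, innerDual_apply]

@[simp] theorem fiberRep_sub (f g : CStarDual C(X, ℂ) E) (x : X) :
    fiberRep (f - g) x = fiberRep f x - fiberRep g x :=
  fiber_ext fun η => by
    rw [inner_fiberRep, inner_sub_left, inner_fiberRep, inner_fiberRep]; rfl

theorem fiberRep_smul (a : C(X, ℂ)) (f : CStarDual C(X, ℂ) E) (x : X) :
    fiberRep (a • f) x = a x • fiberRep f x :=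
  fiber_ext fun η => by
    rw [inner_fiberRep, inner_smul_left, inner_fiberRep, CStarDual.algebra_smul_apply, mul_comm]
    rfl

end Fiber

theorem CStarDual.apply_sub_apply {X E : Type*} [TopologicalSpace X] [CompactSpace X]
    [NormedAddCommGroup E] [NormedSpace ℂ E] [Module C(X, ℂ) E]
    (f : CStarDual C(X, ℂ) E) (ξ η : E) (x : X) : f (ξ - η) x = f ξ x - f η x :=
  congrArg (fun a : C(X, ℂ) => a x) (f.toCLM.map_sub ξ η)

/-! ### Locality of bidual elements, and gluing of local approximants. -/

section Local

variable {X : Type*} [TopologicalSpace X] [CompactSpace X]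
  {E : Type*} [NormedAddCommGroup E] [NormedSpace ℂ E] [Module C(X, ℂ) E] [CStarModule C(X, ℂ) E]

theorem exists_complex_bump [T2Space X] {x : X} {U : Set X} (hU : U ∈ 𝓝 x) :
    ∃ a : C(X, ℂ), a x = 1 ∧ (∀ y ∉ U, a y = 0) ∧ ∀ y, ‖a y‖ ≤ 1 := by
  obtain ⟨f, h0, h1, h01⟩ := exists_continuous_zero_one_of_isClosed
    (isOpen_interior (s := U)).isClosed_compl (isClosed_singleton (x := x))
    (Set.disjoint_singleton_right.mpr fun h => h (mem_interior_iff_mem_nhds.mpr hU))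
  refine ⟨⟨fun y => (f y : ℂ), by fun_prop⟩, ?_, fun y hy => ?_, fun y => ?_⟩
  · simpa using h1 (Set.mem_singleton x)
  · simpa using h0 (fun h => hy (interior_subset h))
  · change ‖(f y : ℂ)‖ ≤ 1
    rw [Complex.norm_real, Real.norm_of_nonneg (h01 y).1]
    exact (h01 y).2

/-- The value at `x` of an element of the second dual is controlled locally around `x`. -/
theorem norm_bidual_apply_le [T2Space X] (F : CStarDual C(X, ℂ) (CStarDual C(X, ℂ) E))
    (f : CStarDual C(X, ℂ) E) {x : X} {C : ℝ} (h : ∀ᶠ y in 𝓝 x, ‖fiberRep f y‖ ≤ C) :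
    ‖F f x‖ ≤ ‖F‖ * C := by
  have hC : 0 ≤ C := (norm_nonneg _).trans h.self_of_nhds
  -- Cutting `f` off by `a` keeps the value of `F f` at `x` but makes the local bound global.
  obtain ⟨a, ha1, ha0, ha⟩ := exists_complex_bump h
  have h1 : ‖a • f‖ ≤ C := norm_le_of_norm_fiberRep_le hC fun y => by
    rw [fiberRep_smul, norm_smul]
    by_cases hy : ‖fiberRep f y‖ ≤ C
    · exact (mul_le_of_le_one_left (norm_nonneg _) (ha y)).trans hy
    · rw [ha0 y hy, norm_zero, zero_mul]; exact hC
  calc ‖F f x‖ = ‖F (a • f) x‖ := by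
        rw [CStarDual.map_smul, ContinuousMap.mul_apply, ha1, one_mul]
    _ ≤ ‖F (a • f)‖ := ContinuousMap.norm_coe_le_norm _ x
    _ ≤ ‖F‖ * ‖a • f‖ := F.toCLM.le_opNorm _
    _ ≤ _ := by gcongr

/-- An element of the second dual is determined by its restriction to `E`. -/
theorem bidual_eq_zero [T2Space X] (F : CStarDual C(X, ℂ) (CStarDual C(X, ℂ) E))
    (hF : ∀ ξ : E, F (innerDual C(X, ℂ) ξ) = 0) : F = 0 := by
  refine CStarDual.ext fun f => ContinuousMap.ext fun x => ?_
  change F f x = 0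
  by_contra hx
  have hx' : 0 < ‖F f x‖ := norm_pos_iff.mpr hx
  set δ := ‖F f x‖ / 2 with hδ
  have hδ0 : 0 < δ := by positivity
  let U : Set X := {y | δ < ‖F f y‖}
  have hU : IsOpen U := isOpen_lt continuous_const (by fun_prop)
  have hxU : x ∈ U := by change δ < ‖F f x‖; linarith
  obtain ⟨τ, hτ0, hτ⟩ : ∃ τ : ℝ, 0 < τ ∧ ‖F‖ * √(3 * τ) ≤ δ := by
    have hlim : Tendsto (fun τ : ℝ => ‖F‖ * √(3 * τ)) (𝓝[>] 0) (𝓝 (‖F‖ * √(3 * 0))) :=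
      (Continuous.tendsto (by fun_prop) 0).mono_left nhdsWithin_le_nhds
    rw [mul_zero, Real.sqrt_zero, mul_zero] at hlim
    obtain ⟨τ, h1, h2⟩ := ((hlim.eventually_lt_const hδ0).and eventually_mem_nhdsWithin).exists
    exact ⟨τ, h2, h1.le⟩
  have hbdd : BddAbove ((fun y => ‖fiberRep f y‖ ^ 2) '' U) := by
    refine ⟨‖f‖ ^ 2, ?_⟩
    rintro _ ⟨y, -, rfl⟩
    exact pow_le_pow_left₀ (norm_nonneg _) (norm_fiberRep_le f y) 2
  -- The fiber norm of `f` can jump upwards near a point; choosing `y` almost maximal in `U` limits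
  -- the jump of its square to `τ`.
  obtain ⟨_, ⟨y, hyU, rfl⟩, hy⟩ := exists_lt_of_lt_csSup
    (s := (fun y => ‖fiberRep f y‖ ^ 2) '' U) ⟨_, x, hxU, rfl⟩ (sub_lt_self _ hτ0)
  obtain ⟨ξ, hξ⟩ := exists_norm_fiberMap_sub_lt y (fiberRep f y) (Real.sqrt_pos.mpr hτ0)
  have expand : ∀ z, ‖fiberMap E z ξ - fiberRep f z‖ ^ 2 =
      ‖fiberRep f z‖ ^ 2 + (‖fiberMap E z ξ‖ ^ 2 - 2 * (f ξ z).re) := by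
    intro z
    rw [norm_sub_rev, norm_sub_sq (𝕜 := ℂ), inner_fiberRep]
    simp only [RCLike.re_to_complex]
    ring
  have hcont : Continuous fun z => ‖fiberMap E z ξ‖ ^ 2 - 2 * (f ξ z).re := by
    have := continuous_norm_fiberMap (X := X) ξ
    fun_prop
  have hyτ : ‖fiberMap E y ξ - fiberRep f y‖ ^ 2 < τ := by
    rw [← Real.sq_sqrt hτ0.le]
    exact pow_lt_pow_left₀ hξ (norm_nonneg _) two_ne_zero
  -- The three `τ` are the error at `y`, the gap to the supremum, and the variation of the
  -- continuous term in `expand`.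
  have hnear : ∀ᶠ z in 𝓝 y, ‖fiberRep (f - innerDual C(X, ℂ) ξ) z‖ ≤ √(3 * τ) := by
    filter_upwards [hU.mem_nhds hyU,
      hcont.continuousAt.eventually_lt_const (lt_add_of_pos_right _ hτ0)] with z hzU hz
    rw [fiberRep_sub, fiberRep_innerDual, norm_sub_rev]
    refine Real.le_sqrt_of_sq_le ?_
    have h1 := le_csSup hbdd ⟨z, hzU, rfl⟩
    have h2 := expand y
    rw [expand z]
    simp only at h1 hy hz
    linarith
  have h1 := norm_bidual_apply_le F _ hnear
  rw [CStarDual.apply_sub_apply, hF, ContinuousMap.zero_apply, sub_zero] at h1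
  have h2 : δ < ‖F f y‖ := hyU
  linarith

theorem isometry_innerDualCLM : Isometry (innerDualCLM C(X, ℂ) E) :=
  AddMonoidHomClass.isometry_of_norm _ fun ξ =>
    (norm_innerDual_le ξ).antisymm <| norm_le_of_norm_fiberMap_le (X := X) (norm_nonneg _)
      fun x => by rw [← fiberRep_innerDual]; exact norm_fiberRep_le _ x

/-- A bounded module map that is locally uniformly approximated by elements of `E` belongs to
`E`. -/
theorem exists_innerDual_eq [T2Space X] [CompleteSpace E] (g : CStarDual C(X, ℂ) E)
    (h : ∀ ε : ℝ, 0 < ε → ∀ x : X, ∃ ξ : E,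
      ∀ᶠ y in 𝓝 x, ‖fiberMap E y ξ - fiberRep g y‖ ≤ ε) :
    ∃ ξ : E, innerDual C(X, ℂ) ξ = g := by
  have hclosed := (isometry_innerDualCLM (X := X) (E := E)).isClosedEmbedding.isClosed_range
  suffices g ∈ closure (Set.range (innerDualCLM C(X, ℂ) E)) by
    rwa [hclosed.closure_eq] at this
  refine Metric.mem_closure_range_iff.mpr fun ε hε => ?_
  choose ξ hξ using h (ε / 2) (half_pos hε)
  -- On each fiber the glued element is a convex combination of those approximants that are good
  -- there.
  obtain ⟨t, ht⟩ := CompactSpace.elim_nhds_subcover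
    (fun x => interior {y | ‖fiberMap E y (ξ x) - fiberRep g y‖ ≤ ε / 2})
    (fun x => interior_mem_nhds.mpr (hξ x))
  obtain ⟨ρ, hρ⟩ := PartitionOfUnity.exists_isSubordinate isClosed_univ
    (fun i : t => interior {y | ‖fiberMap E y (ξ i) - fiberRep g y‖ ≤ ε / 2})
    (fun _ => isOpen_interior) (fun y _ => by
      have hy : y ∈ ⋃ x ∈ t, interior {y | ‖fiberMap E y (ξ x) - fiberRep g y‖ ≤ ε / 2} := by
        rw [ht]; trivial
      simpa only [Set.mem_iUnion, Subtype.exists] using hy)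
  let a : t → C(X, ℂ) := fun i => ⟨fun y => (ρ i y : ℂ), by fun_prop⟩
  refine ⟨∑ i, a i • ξ i, ?_⟩
  rw [dist_eq_norm]
  refine (norm_le_of_norm_fiberRep_le (half_pos hε).le fun y => ?_).trans_lt (half_lt_self hε)
  have hsum : ∑ i, ρ i y = 1 := by
    rw [← finsum_eq_sum_of_fintype]; exact ρ.sum_eq_one (Set.mem_univ y)
  have hval : fiberRep g y - fiberMap E y (∑ i, a i • ξ i) =
      ∑ i, (ρ i y : ℂ) • (fiberRep g y - fiberMap E y (ξ i)) := by
    simp only [smul_sub, Finset.sum_sub_distrib, ← Finset.sum_smul, map_sum, fiberMap_smul]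
    rw [← Complex.ofReal_sum, hsum, Complex.ofReal_one, one_smul]
    rfl
  rw [innerDualCLM_apply, fiberRep_sub, fiberRep_innerDual, hval]
  calc _ ≤ ∑ i, ‖(ρ i y : ℂ) • (fiberRep g y - fiberMap E y (ξ i))‖ := norm_sum_le _ _
    _ ≤ ∑ i, ρ i y * (ε / 2) := by
        refine Finset.sum_le_sum fun i _ => ?_
        rw [norm_smul, Complex.norm_real, Real.norm_of_nonneg (ρ.nonneg i y)]
        by_cases hi : y ∈ tsupport (ρ i)
        · have := interior_subset (hρ i hi)
          rw [norm_sub_rev]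
          exact mul_le_mul_of_nonneg_left this (ρ.nonneg i y)
        · rw [image_eq_zero_of_notMem_tsupport hi, zero_mul, zero_mul]
    _ = ε / 2 := by rw [← Finset.sum_mul, hsum, one_mul]

end Local

/-- A bounded sequence in `E` whose inner products with the elements of a generating set converge
defines an element of the dual module. -/
theorem exists_dual_tendsto_inner {A E : Type*} [CStarAlgebra A] [PartialOrder A]
    [StarOrderedRing A] [NormedAddCommGroup E] [NormedSpace ℂ E] [CompleteSpace E] [Module A E]
    [CStarModule A E] {s : ℕ → E} {C : ℝ} (hs : ∀ N, ‖s N‖ ≤ C) {D : Set E}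
    (hD : Dense (Submodule.span A D : Set E))
    (h : ∀ η ∈ D, CauchySeq fun N => (inner A (s N) η : A)) :
    ∃ f : CStarDual A E, ∀ η, Tendsto (fun N => (inner A (s N) η : A)) atTop (𝓝 (f η)) := by
  have hC : 0 ≤ C := (norm_nonneg _).trans (hs 0)
  let M : Submodule A E :=
    { carrier := {η | ∃ a : A, Tendsto (fun N => (inner A (s N) η : A)) atTop (𝓝 a)}
      zero_mem' := ⟨0, by simp⟩
      add_mem' := by
        rintro η ζ ⟨a, ha⟩ ⟨b, hb⟩
        exact ⟨a + b, by simpa using ha.add hb⟩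
      smul_mem' := by
        rintro b η ⟨a, ha⟩
        exact ⟨b * a, by simpa using ha.const_mul b⟩ }
  have hM : Submodule.span A D ≤ M :=
    Submodule.span_le.mpr fun η hη => cauchySeq_tendsto_of_complete (h η hη)
  have hall : ∀ η, ∃ a : A, Tendsto (fun N => (inner A (s N) η : A)) atTop (𝓝 a) := by
    intro η
    -- A three-epsilon argument: the bound on `s` extends convergence from the dense span to all of
    -- `E`.
    refine cauchySeq_tendsto_of_complete (Metric.cauchySeq_iff.mpr fun ε hε => ?_)
    obtain ⟨ζ, hζ, hηζ⟩ := hD.exists_dist_lt η (ε := ε / (3 * (C + 1))) (by positivity)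
    obtain ⟨a, ha⟩ := hM hζ
    obtain ⟨N, hN⟩ := Metric.cauchySeq_iff.mp ha.cauchySeq (ε / 3) (by positivity)
    have hclose : ∀ n, dist (inner A (s n) η : A) (inner A (s n) ζ) < ε / 3 := by
      intro n
      rw [dist_eq_norm, ← CStarModule.inner_sub_right]
      refine (CStarModule.norm_inner_le E).trans_lt ?_
      rw [dist_eq_norm, lt_div_iff₀ (by positivity)] at hηζ
      nlinarith [mul_le_mul_of_nonneg_right (hs n) (norm_nonneg (η - ζ)), norm_nonneg (η - ζ)]
    refine ⟨N, fun m hm n hn => ?_⟩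
    have h1 := dist_triangle4 (inner A (s m) η : A) (inner A (s m) ζ) (inner A (s n) ζ)
      (inner A (s n) η)
    have h2 := hclose n
    rw [dist_comm] at h2
    linarith [hclose m, hN m hm n hn]
  choose φ hφ using hall
  -- Boundedness of the pointwise limit is Banach–Steinhaus.
  refine ⟨CStarDual.ofCLM (continuousLinearMapOfTendsto
    (fun N => (CStarModule.innerSL (s N) : E →L[ℂ] A)) (tendsto_pi_nhds.mpr hφ)) fun a η => ?_, hφ⟩
  change φ (a • η) = a * φ η
  refine tendsto_nhds_unique (hφ (a • η)) ?_
  simpa using (hφ η).const_mul a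

/-! ### Construction of a single hump. -/

section Hump

variable {X : Type*} [MetricSpace X] [CompactSpace X]
  {E : Type*} [NormedAddCommGroup E] [NormedSpace ℂ E] [Module C(X, ℂ) E] [CStarModule C(X, ℂ) E]

/-- Take `ξ` close to `g` at `x₀`, then `x` near `x₀` where they differ by more than `ε`. The hump
lifts the difference `g - ξ` at `x`, cut off near `x`. Its pairing with `η ∈ S` is close to `g η -
⟨ξ, η⟩`, continuous and small at `x₀`. Its pairing with `g` is about `‖g - ξ‖² + (Re g ξ - ‖ξ‖²)`,
where the bracket is continuous and nearly zero at `x₀`, hence above `ε² - ε² / 4`. -/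
theorem exists_hump (g : CStarDual C(X, ℂ) E) {x₀ : X} {ε : ℝ} (hε : 0 < ε)
    (hbad : ∀ ξ : E, ∃ᶠ y in 𝓝 x₀, ε < ‖fiberMap E y ξ - fiberRep g y‖)
    {τ : ℝ} (hτ : 0 < τ) (S : Finset E) :
    ∃ (x : X) (ζ : E) (ρ : ℝ), 0 < ρ ∧ ρ < dist x x₀ ∧ dist x x₀ < τ ∧
      (∀ y, fiberMap E y ζ ≠ 0 → ρ < dist y x₀ ∧ dist y x₀ < τ) ∧
      ‖ζ‖ ≤ 2 * ‖g‖ + 3 ∧ (∀ η ∈ S, ‖(inner C(X, ℂ) ζ η : C(X, ℂ))‖ ≤ τ) ∧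
      ε ^ 2 / 2 ≤ (g ζ x).re := by
  obtain ⟨ξ, hξn, hξc, hξε, hξS⟩ : ∃ ξ : E, ‖fiberMap E x₀ ξ‖ < ‖g‖ + 1 ∧
      -(ε ^ 2 / 4) < (g ξ x₀).re - ‖fiberMap E x₀ ξ‖ ^ 2 ∧
      ‖fiberMap E x₀ ξ - fiberRep g x₀‖ < ε ∧
      ∀ η ∈ S, ‖g η x₀ - inner C(X, ℂ) ξ η x₀‖ < τ := by
    have h1 : ∀ᶠ v in 𝓝 (fiberRep g x₀), ‖v‖ < ‖g‖ + 1 ∧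
        -(ε ^ 2 / 4) < (inner ℂ (fiberRep g x₀) v : ℂ).re - ‖v‖ ^ 2 ∧
        ‖v - fiberRep g x₀‖ < ε ∧
        ∀ η ∈ S, ‖g η x₀ - inner ℂ v (fiberMap E x₀ η)‖ < τ := by
      refine Eventually.and ?_ (Eventually.and ?_ (Eventually.and ?_ ?_))
      · exact Tendsto.eventually_lt_const ((norm_fiberRep_le g x₀).trans_lt (lt_add_one _))
          (Continuous.tendsto (by fun_prop) _)
      · have h3 : (inner ℂ (fiberRep g x₀) (fiberRep g x₀) : ℂ).re = ‖fiberRep g x₀‖ ^ 2 :=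
          (norm_sq_eq_re_inner (𝕜 := ℂ) _).symm
        refine Tendsto.eventually_const_lt (v := (inner ℂ (fiberRep g x₀)
          (fiberRep g x₀) : ℂ).re - ‖fiberRep g x₀‖ ^ 2) ?_ (Continuous.tendsto (by fun_prop) _)
        linarith [sq_pos_of_pos hε]
      · exact Tendsto.eventually_lt_const (v := ‖fiberRep g x₀ - fiberRep g x₀‖) (by simpa)
          (Continuous.tendsto (by fun_prop) _)
      · refine (Finset.eventually_all S).mpr fun η hη => ?_
        exact Tendsto.eventually_lt_const
          (v := ‖g η x₀ - inner ℂ (fiberRep g x₀) (fiberMap E x₀ η)‖) (by simpa)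
          (Continuous.tendsto (by fun_prop) _)
    obtain ⟨ξ, hξ⟩ := (denseRange_fiberMap x₀).mem_nhds h1
    exact ⟨ξ, by simpa only [Set.mem_ofPred_eq, inner_fiberRep, inner_fiberMap] using hξ⟩
  have hev : ∀ᶠ y in 𝓝 x₀, ‖fiberMap E y ξ‖ < ‖g‖ + 1 ∧
      -(ε ^ 2 / 4) < (g ξ y).re - ‖fiberMap E y ξ‖ ^ 2 ∧
      dist y x₀ < τ ∧ ∀ η ∈ S, ‖g η y - inner C(X, ℂ) ξ η y‖ < τ := by
    have hc := continuous_norm_fiberMap (X := X) ξ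
    refine Eventually.and ?_ (Eventually.and ?_ (Eventually.and ?_ ?_))
    · exact hc.continuousAt.eventually_lt_const hξn
    · exact Tendsto.eventually_const_lt hξc (Continuous.tendsto (by fun_prop) _)
    · exact Metric.ball_mem_nhds x₀ hτ
    · refine (Finset.eventually_all S).mpr fun η hη => ?_
      exact Tendsto.eventually_lt_const (hξS η hη) (Continuous.tendsto (by fun_prop) _)
  obtain ⟨x, hx, hxn, hxc, hxτ, hxS⟩ := ((hbad ξ).and_eventually hev).exists
  -- At `x₀` itself the difference is below `ε`, so `x ≠ x₀`, which leaves room for an inner radius.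
  have hx0 : 0 < dist x x₀ := dist_pos.mpr fun h => by subst h; exact hx.not_gt hξε
  obtain ⟨ζ, hζn, hζr, hζS⟩ : ∃ ζ : E, ‖fiberMap E x ζ‖ < 2 * ‖g‖ + 3 ∧
      ε ^ 2 / 2 < (g ζ x).re ∧ ∀ η ∈ S, ‖inner C(X, ℂ) ζ η x‖ < τ := by
    have h1 : ∀ᶠ v in 𝓝 (fiberRep g x - fiberMap E x ξ), ‖v‖ < 2 * ‖g‖ + 3 ∧
        ε ^ 2 / 2 < (inner ℂ (fiberRep g x) v : ℂ).re ∧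
        ∀ η ∈ S, ‖(inner ℂ v (fiberMap E x η) : ℂ)‖ < τ := by
      refine Eventually.and ?_ (Eventually.and ?_ ?_)
      · refine Tendsto.eventually_lt_const ?_ (Continuous.tendsto (by fun_prop) _)
        linarith [norm_sub_le (fiberRep g x) (fiberMap E x ξ), norm_fiberRep_le g x]
      · refine Tendsto.eventually_const_lt
          (v := (inner ℂ (fiberRep g x) (fiberRep g x - fiberMap E x ξ) : ℂ).re) ?_
          (Continuous.tendsto (by fun_prop) _)
        have h2 := norm_sub_sq (𝕜 := ℂ) (fiberRep g x) (fiberMap E x ξ)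
        rw [norm_sub_rev, inner_fiberRep] at h2
        have h3 : (inner ℂ (fiberRep g x) (fiberRep g x) : ℂ).re = ‖fiberRep g x‖ ^ 2 :=
          (norm_sq_eq_re_inner (𝕜 := ℂ) _).symm
        have h4 := pow_lt_pow_left₀ hx hε.le two_ne_zero
        rw [inner_sub_right, inner_fiberRep, Complex.sub_re, h3]
        simp only [RCLike.re_to_complex] at h2
        linarith [sq_pos_of_pos hε]
      · refine (Finset.eventually_all S).mpr fun η hη => ?_
        refine Tendsto.eventually_lt_const
          (v := ‖(inner ℂ (fiberRep g x - fiberMap E x ξ) (fiberMap E x η) : ℂ)‖) ?_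
          (Continuous.tendsto (by fun_prop) _)
        rw [inner_sub_left, inner_fiberRep, inner_fiberMap]
        exact hxS η hη
    obtain ⟨ζ, hζ⟩ := (denseRange_fiberMap x).mem_nhds h1
    exact ⟨ζ, by simpa only [Set.mem_ofPred_eq, inner_fiberRep, inner_fiberMap] using hζ⟩
  have hW : ∀ᶠ y in 𝓝 x, ‖fiberMap E y ζ‖ < 2 * ‖g‖ + 3 ∧
      (dist x x₀ / 2 < dist y x₀ ∧ dist y x₀ < τ) ∧ ∀ η ∈ S, ‖inner C(X, ℂ) ζ η y‖ < τ := by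
    refine Eventually.and ?_ (Eventually.and (Eventually.and ?_ ?_) ?_)
    · exact (continuous_norm_fiberMap ζ).continuousAt.eventually_lt_const hζn
    · exact Tendsto.eventually_const_lt (half_lt_self hx0) (Continuous.tendsto (by fun_prop) _)
    · exact Tendsto.eventually_lt_const hxτ (Continuous.tendsto (by fun_prop) _)
    · refine (Finset.eventually_all S).mpr fun η hη => ?_
      exact Tendsto.eventually_lt_const (hζS η hη) (Continuous.tendsto (by fun_prop) _)
  obtain ⟨a, ha1, ha0, ha⟩ := exists_complex_bump hW
  refine ⟨x, a • ζ, dist x x₀ / 2, half_pos hx0, half_lt_self hx0, hxτ, fun y hy => ?_, ?_,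
    fun η hη => ?_, ?_⟩
  · by_contra hcon
    refine hy ?_
    rw [fiberMap_smul, ha0 y (fun h => hcon h.2.1), zero_smul]
  · refine norm_le_of_norm_fiberMap_le (X := X) (by positivity) fun y => ?_
    rw [fiberMap_smul, norm_smul]
    by_cases hy : y ∈ {y | ‖fiberMap E y ζ‖ < 2 * ‖g‖ + 3 ∧
      (dist x x₀ / 2 < dist y x₀ ∧ dist y x₀ < τ) ∧ ∀ η ∈ S, ‖inner C(X, ℂ) ζ η y‖ < τ}
    · exact (mul_le_of_le_one_left (norm_nonneg _) (ha y)).trans hy.1.le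
    · rw [ha0 y hy, norm_zero, zero_mul]; positivity
  · refine (ContinuousMap.norm_le _ hτ.le).mpr fun y => ?_
    rw [CStarModule.inner_op_smul_left, ContinuousMap.mul_apply, norm_mul, mul_comm]
    change ‖star (a y)‖ * _ ≤ _
    rw [norm_star]
    by_cases hy : y ∈ {y | ‖fiberMap E y ζ‖ < 2 * ‖g‖ + 3 ∧
      (dist x x₀ / 2 < dist y x₀ ∧ dist y x₀ < τ) ∧ ∀ η ∈ S, ‖inner C(X, ℂ) ζ η y‖ < τ}
    · exact (mul_le_of_le_one_left (norm_nonneg _) (ha y)).trans (hy.2.2 η hη).le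
    · rw [ha0 y hy, norm_zero, zero_mul]; exact hτ.le
  · rw [CStarDual.map_smul, ContinuousMap.mul_apply, ha1, one_mul]
    exact hζr.le

end Hump

/-! ### The gliding hump contradiction. -/

section GlidingHump

variable {X : Type*} [MetricSpace X] [CompactSpace X]
  {E : Type*} [NormedAddCommGroup E] [NormedSpace ℂ E] [Module C(X, ℂ) E] [CStarModule C(X, ℂ) E]

/-- Humps accumulating at `x₀`, with supports in disjoint annuli around `x₀`. -/
theorem exists_hump_sequence (g : CStarDual C(X, ℂ) E) {x₀ : X} {ε : ℝ} (hε : 0 < ε)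
    (hbad : ∀ ξ : E, ∃ᶠ y in 𝓝 x₀, ε < ‖fiberMap E y ξ - fiberRep g y‖) (S : ℕ → Finset E) :
    ∃ (x : ℕ → X) (ζ : ℕ → E) (U : ℕ → Set X),
      Tendsto x atTop (𝓝 x₀) ∧ (∀ n, U n ∈ 𝓝 (x n)) ∧
      (∀ n y, fiberMap E y (ζ n) ≠ 0 → y ∈ U n) ∧
      (∀ m n, m ≠ n → Disjoint (U m) (U n)) ∧
      (∀ n, ‖ζ n‖ ≤ 2 * ‖g‖ + 3) ∧
      (∀ n, ∀ η ∈ S n, ‖(inner C(X, ℂ) (ζ n) η : C(X, ℂ))‖ ≤ (1 / 2) ^ n) ∧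
      ∀ n, ε ^ 2 / 2 ≤ (g (ζ n) (x n)).re := by
  choose x ζ ρ hρ0 hρx hxτ hsupp hnorm hinner hre using
    fun (τ : {τ : ℝ // 0 < τ}) (S : Finset E) => exists_hump g hε hbad τ.2 S
  -- Each outer radius is at most the previous inner radius, so the annuli are disjoint; the power
  -- of `1 / 2` gives convergence and summability.
  let T : ℕ → {τ : ℝ // 0 < τ} := fun n => Nat.rec ⟨1, one_pos⟩
    (fun n τ => ⟨min (ρ τ (S n)) ((1 / 2) ^ (n + 1)), lt_min (hρ0 _ _) (by positivity)⟩) n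
  have hT1 : ∀ n, (T (n + 1)).1 ≤ ρ (T n) (S n) := fun n => min_le_left _ _
  have hT2 : ∀ n : ℕ, (T n).1 ≤ (1 / 2 : ℝ) ^ n := fun n => by
    cases n with
    | zero => exact (pow_zero _).ge
    | succ n => exact min_le_right _ _
  have hTanti : Antitone fun n : ℕ => (T n).1 := antitone_nat_of_succ_le fun n =>
    (hT1 n).trans ((hρx _ _).trans (hxτ _ _)).le
  have hdisj : ∀ m n, m < n → Disjoint {y | ρ (T m) (S m) < dist y x₀ ∧ dist y x₀ < (T m).1}
      {y | ρ (T n) (S n) < dist y x₀ ∧ dist y x₀ < (T n).1} := by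
    refine fun m n hmn => Set.disjoint_left.mpr fun y hy hy' => ?_
    have h1 : ρ (T m) (S m) < dist y x₀ := hy.1
    have h2 : dist y x₀ < (T n).1 := hy'.2
    have h3 : (T n).1 ≤ (T (m + 1)).1 := hTanti hmn
    linarith [hT1 m]
  refine ⟨fun n => x (T n) (S n), fun n => ζ (T n) (S n),
    fun n => {y | ρ (T n) (S n) < dist y x₀ ∧ dist y x₀ < (T n).1}, ?_, fun n => ?_,
    fun n => hsupp _ _, fun m n hmn => ?_, fun n => hnorm _ _,
    fun n η hη => (hinner _ _ η hη).trans (hT2 n), fun n => hre _ _⟩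
  · refine tendsto_iff_dist_tendsto_zero.mpr (squeeze_zero (fun _ => dist_nonneg)
      (fun n => (hxτ _ _).le.trans (hT2 n)) ?_)
    exact tendsto_pow_atTop_nhds_zero_of_lt_one (by norm_num) (by norm_num)
  · have hd : Continuous fun y : X => dist y x₀ := by fun_prop
    exact (hd.continuousAt.eventually_const_lt (hρx _ _)).and
      (hd.continuousAt.eventually_lt_const (hxτ _ _))
  · rcases hmn.lt_or_gt with h | h
    · exact hdisj m n h
    · exact (hdisj n m h).symm

/-- The restriction to a countably generated `E` of an element of the second dual is locally
approximated by elements of `E`. -/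
theorem restrictBidual_locally_approx [CompleteSpace E]
    (hE : IsCountablyGeneratedModule C(X, ℂ) E)
    (F : CStarDual C(X, ℂ) (CStarDual C(X, ℂ) E)) {ε : ℝ} (hε : 0 < ε) (x₀ : X) :
    ∃ ξ : E, ∀ᶠ y in 𝓝 x₀, ‖fiberMap E y ξ - fiberRep (restrictBidual F) y‖ ≤ ε := by
  classical
  by_contra! hbad
  obtain ⟨D, hDc, hD⟩ := hE
  obtain ⟨η, hη⟩ := Set.countable_iff_exists_subset_range.mp hDc
  -- Hump `n` is tested on the first `n` generators, so each generator is tested by all but finitely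
  -- many humps.
  obtain ⟨x, ζ, U, hx, hU, hsupp, hdisj, hnorm, hinner, hre⟩ :=
    exists_hump_sequence (restrictBidual F) hε hbad fun n => (Finset.range n).image η
  let c : ℕ → ℂ := fun n => (-1) ^ n
  have hc : ∀ n, ‖c n‖ = 1 := fun n => by simp [c]
  let s : ℕ → E := fun N => ∑ n ∈ Finset.range N, c n • ζ n
  have hsingle : ∀ N n y, y ∈ U n → fiberMap E y (s N) =
      if n < N then c n • fiberMap E y (ζ n) else 0 := by
    intro N n y hy
    have hz : ∀ m ≠ n, fiberMap E y (ζ m) = 0 := fun m hmn => by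
      by_contra h
      exact Set.disjoint_left.mp (hdisj m n hmn) (hsupp m y h) hy
    simp only [s, map_sum, map_smul]
    split_ifs with h
    · exact Finset.sum_eq_single_of_mem n (Finset.mem_range.mpr h) fun m _ hmn => by
        rw [hz m hmn, smul_zero]
    · refine Finset.sum_eq_zero fun m hm => ?_
      rw [hz m fun hmn => h (hmn ▸ Finset.mem_range.mp hm), smul_zero]
  -- At most one hump is nonzero at each point, so the partial sums are no larger than single humps.
  have hs : ∀ N, ‖s N‖ ≤ 2 * ‖restrictBidual F‖ + 3 := by
    refine fun N => norm_le_of_norm_fiberMap_le (X := X) (by positivity) fun y => ?_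
    by_cases h : ∃ n, y ∈ U n
    · obtain ⟨n, hn⟩ := h
      rw [hsingle N n y hn]
      split_ifs
      · rw [norm_smul, hc, one_mul]
        exact (norm_fiberMap_le y _).trans (hnorm n)
      · rw [norm_zero]; positivity
    · have h0 : fiberMap E y (s N) = 0 := by
        simp only [s, map_sum, map_smul]
        refine Finset.sum_eq_zero fun n _ => ?_
        rw [not_not.mp fun h' => h ⟨n, hsupp n y h'⟩, smul_zero]
      rw [h0, norm_zero]; positivity
  have hconv : ∀ ω ∈ D, CauchySeq fun N => (inner C(X, ℂ) (s N) ω : C(X, ℂ)) := by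
    intro ω hω
    obtain ⟨k, rfl⟩ := hη hω
    have hsum : Summable fun n => (inner C(X, ℂ) (c n • ζ n) (η k) : C(X, ℂ)) := by
      refine Summable.of_norm_bounded_eventually_nat summable_geometric_two ?_
      filter_upwards [eventually_gt_atTop k] with n hn
      rw [CStarModule.inner_smul_left_complex, norm_smul, norm_star, hc, one_mul]
      exact hinner n _ (Finset.mem_image_of_mem _ (Finset.mem_range.mpr hn))
    simpa only [s, CStarModule.inner_sum_left] using hsum.hasSum.tendsto_sum_nat.cauchySeq
  obtain ⟨f, hf⟩ := exists_dual_tendsto_inner hs hD hconv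
  have hfU : ∀ n, ∀ y ∈ U n, fiberRep f y = fiberMap E y (c n • ζ n) := by
    intro n y hy
    refine fiber_ext fun ω => ?_
    rw [inner_fiberRep]
    have h1 : Tendsto (fun N => (inner C(X, ℂ) (s N) ω : C(X, ℂ)) y) atTop (𝓝 (f ω y)) :=
      ((continuous_eval_const y).tendsto _).comp (hf ω)
    refine tendsto_nhds_unique h1 (tendsto_const_nhds.congr' ?_)
    filter_upwards [eventually_gt_atTop n] with N hN
    rw [← inner_fiberMap y (s N), hsingle N n y hy, if_pos hN, map_smul]
  -- Near `x n` the section of `f` is the `n`-th signed hump, so locality of `F` gives the value.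
  have hFf : ∀ n, F f (x n) = c n * restrictBidual F (ζ n) (x n) := by
    intro n
    have h1 : ‖F (f - innerDual C(X, ℂ) (c n • ζ n)) (x n)‖ ≤ ‖F‖ * 0 := by
      refine norm_bidual_apply_le F _ ?_
      filter_upwards [hU n] with y hy
      rw [fiberRep_sub, fiberRep_innerDual, hfU n y hy, sub_self, norm_zero]
    rw [mul_zero, norm_le_zero_iff, CStarDual.apply_sub_apply, sub_eq_zero] at h1
    rw [h1, ← restrictBidual_apply]
    exact congrArg (fun a : C(X, ℂ) => a (x n)) ((restrictBidual F).toCLM.map_smul (c n) (ζ n))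
  -- Continuity of `F f` at `x₀` is incompatible with the alternating signs.
  have hlim : Tendsto (fun n => (F f (x n)).re) atTop (𝓝 (F f x₀).re) :=
    (Continuous.tendsto (f := fun y => (F f y).re) (by fun_prop) x₀).comp hx
  have heven : ε ^ 2 / 2 ≤ (F f x₀).re := by
    refine ge_of_tendsto' (hlim.comp (tendsto_id.const_mul_atTop' two_pos)) fun n => ?_
    have := hre (2 * n)
    simpa [hFf, c, pow_mul] using this
  have hodd : (F f x₀).re ≤ -(ε ^ 2 / 2) := by
    refine le_of_tendsto' (hlim.comp
      ((tendsto_add_atTop_nat 1).comp (tendsto_id.const_mul_atTop' two_pos))) fun n => ?_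
    have := hre (2 * n + 1)
    simpa [hFf, c, pow_mul, pow_succ] using this
  linarith [sq_pos_of_pos hε]

end GlidingHump

/-! ### Surjectivity onto the bidual. -/

theorem mainTheorem7 {X : Type*} [MetricSpace X] [CompactSpace X]
    {E : Type*} [NormedAddCommGroup E] [NormedSpace ℂ E] [Module C(X, ℂ) E]
    [CStarModule C(X, ℂ) E] [CompleteSpace E]
    (hE : IsCountablyGeneratedModule C(X, ℂ) E) :
    IsCStarReflexive C(X, ℂ) E := by
  refine ⟨isometry_toBidual C(X, ℂ) E, fun F => ?_⟩
  obtain ⟨ξ, hξ⟩ := exists_innerDual_eq (restrictBidual F) fun ε hε x =>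
    restrictBidual_locally_approx hE F hε x
  -- `F` and the image of `ξ` agree on the copy of `E` in its dual, which determines a bidual
  -- element.
  refine ⟨ξ, (sub_eq_zero.mp
    (bidual_eq_zero (F - CStarDual.toBidual C(X, ℂ) E ξ) fun η => ?_)).symm⟩
  change F (innerDual C(X, ℂ) η) - CStarDual.toBidual C(X, ℂ) E ξ (innerDual C(X, ℂ) η) = 0
  rw [CStarDual.toBidual_apply, innerDual_apply, CStarModule.star_inner, ← restrictBidual_apply,
    ← hξ, innerDual_apply, sub_self]
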